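/- Let $n,m$ be dimensions, let $\|\cdot\|$ be the Euclidean norm, and let $a,\lambda\in\mathbb{R}^n$, $d\in\mathbb{R}^m$ satisfy $\|d\|<\|a\|=1$, $\|\lambda\|=1$ and $\lambda\neq\pm a$. Put $$H=\{(x,y)\in\mathbb{R}^{n+m}: a^{\mathsf T}x+d^{\mathsf T}y=-1\},\qquad S_{\le 0}=\{(x,y)\in\mathbb{R}^{n+m}: \|x\|\le\|y\|,\ a^{\mathsf T}x+d^{\mathsf T}y\le 0\},$$ $$\varphi_\lambda(y)=\max_x\{\lambda^{\mathsf T}x : \|x\|\le\|y\|,\ a^{\mathsf T}x+d^{\mathsf T}y\le 0\}\qquad (y\in\mathbb{R}^m),$$ and for $\beta\in\mathbb{R}^m$ with $\|\beta\|=1$ put $$r(\beta)=\begin{cases}0, & \text{if }\lambda^{\mathsf T}a+d^{\mathsf T}\beta\le 0,\\[2pt] \dfrac{d^{\mathsf T}\beta+\lambda^{\mathsf T}a\,\varphi_\lambda(\beta)}{\varphi_\lambda(\beta)+d^{\mathsf T}\beta\,\lambda^{\mathsf T}a}, & \text{otherwise.}\end{cases}$$ A set $C\subseteq\mathbb{R}^{n+m}$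 is called *$S$-free with respect to $H$* if $C$ is closed and convex and the interior of $C\cap H$ in the induced topology of $H$ contains no point of $S\cap H$. It is called *maximal $S$-free with respect to $H$* if it is $S$-free with respect to $H$ and every $C'\supseteq C$ that is $S$-free with respect to $H$ satisfies $C'\cap H\subseteq C\cap H$. Then the following hold. 1. The maximum defining $\varphi_\lambda(y)$ is attained for every $y\in\mathbb{R}^m$, and $\varphi_\lambda$ is differentiable at every unit vector $\beta$. 2. For every unit vector $\beta$, $r(\beta)$ is the unique optimal solution of the Lagrangian dual $\min_{\theta\ge 0}\ \|\lambda-\theta a\|\,\|\beta\|-\theta\, d^{\mathsf T}\beta$ of the problem defining $\varphi_\lambda(\beta)$, and the optimal value of this dual is $\varphi_\lambda(\beta)$. 3. The set $$C=\{(x,y)\in\mathbb{R}^{n+m}: -\lambda^{\mathsf T}x+\nabla\varphi_\lambda(\beta)^{\mathsf T}y\le r(\beta)\ \text{ for all }\beta\in\mathbb{R}^m\text{ with }\|\beta\|=1\}$$ is maximal $S_{\le 0}$-free with respect to $H$. 4. If $\lambda=\bar x/\|\bar x\|$ for some $(\bar x,\bar y)\in H$ with $\|\bar x\|>\|\bar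 y\|$, then $(\bar x,\bar y)$ lies in the interior of $C$. -/

import Mathlib

namespace QuadraticFree

/-- `ℝⁿ` with the Euclidean norm. -/
abbrev Vec (n : ℕ) := EuclideanSpace ℝ (Fin n)

/-- `C` is `S`-free with respect to `H`: `C` is closed and convex, and the interior of `C ∩ H`
in the topology that `H` inherits from the ambient space contains no point of `S ∩ H`. -/
structure IsFreeWrt {E : Type*} [TopologicalSpace E] [AddCommGroup E] [Module ℝ E]
    (S H C : Set E) : Prop where
  isClosed : IsClosed C
  convex : Convex ℝ C
  free : Disjoint (interior ((Subtype.val : H → E) ⁻¹' C)) ((Subtype.val : H → E) ⁻¹' S)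

/-- `C` is maximal `S`-free with respect to `H`: it is `S`-free with respect to `H`, and every
`C' ⊇ C` that is `S`-free with respect to `H` satisfies `C' ∩ H ⊆ C ∩ H`. -/
structure IsMaximalFreeWrt {E : Type*} [TopologicalSpace E] [AddCommGroup E] [Module ℝ E]
    (S H C : Set E) : Prop where
  isFree : IsFreeWrt S H C
  maximal : ∀ C' : Set E, C ⊆ C' → IsFreeWrt S H C' → C' ∩ H ⊆ C ∩ H

/-- The hyperplane `aᵀx + dᵀy = -1`. -/
def hyperplane {n m : ℕ} (a : Vec n) (d : Vec m) : Set (Vec n × Vec m) :=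
  {p | inner ℝ a p.1 + inner ℝ d p.2 = -1}

/-- The set `S_{≤0}`, given by `‖x‖ ≤ ‖y‖` and `aᵀx + dᵀy ≤ 0`. -/
def homogSet {n m : ℕ} (a : Vec n) (d : Vec m) : Set (Vec n × Vec m) :=
  {p | ‖p.1‖ ≤ ‖p.2‖ ∧ inner ℝ a p.1 + inner ℝ d p.2 ≤ 0}

/-- The feasible set `{x : ‖x‖ ≤ ‖y‖, aᵀx + dᵀy ≤ 0}` of the problem that defines `phi`. -/
def feasible {n m : ℕ} (a : Vec n) (d y : Vec m) : Set (Vec n) :=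
  {x | ‖x‖ ≤ ‖y‖ ∧ inner ℝ a x + inner ℝ d y ≤ 0}

/-- `φ_λ(y) = max {λᵀx : ‖x‖ ≤ ‖y‖, aᵀx + dᵀy ≤ 0}`. -/
noncomputable def phi {n m : ℕ} (a l : Vec n) (d y : Vec m) : ℝ :=
  sSup ((fun x : Vec n => inner ℝ l x) '' feasible a d y)

/-- The objective `θ ↦ ‖λ - θ a‖ ‖y‖ - θ dᵀy` of the Lagrangian dual (to be minimized over
`θ ≥ 0`) of the problem that defines `phi`. -/
noncomputable def dualObjective {n m : ℕ} (a l : Vec n) (d y : Vec m) (θ : ℝ) : ℝ :=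
  ‖l - θ • a‖ * ‖y‖ - θ * inner ℝ d y

open Classical in
/-- The relaxation `r(β)` of the inequality indexed by a unit vector `β`. -/
noncomputable def relax {n m : ℕ} (a l : Vec n) (d β : Vec m) : ℝ :=
  if inner ℝ l a + inner ℝ d β ≤ 0 then 0
  else (inner ℝ d β + inner ℝ l a * phi a l d β) / (phi a l d β + inner ℝ d β * inner ℝ l a)

/-- The set of all `(x, y)` with `-λᵀx + ∇φ_λ(β)ᵀy ≤ r(β)` for every unit vector `β`. -/
noncomputable def relaxedSet {n m : ℕ} (a l : Vec n) (d : Vec m) : Set (Vec n × Vec m) :=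
  {p | ∀ β : Vec m, ‖β‖ = 1 →
    -inner ℝ l p.1 + inner ℝ (gradient (phi a l d) β) p.2 ≤ relax a l d β}

end QuadraticFree

/-! Write `l = cos σ w + sin σ a` with `w` a unit vector orthogonal to `a`, and let `u ν = cos ν w -
sin ν a`, so that `l = u (-σ)`. For a unit `β` the maximizer is `u ν` with contact angle `ν = max
(arcsin ⟪d, β⟫) (-σ)`. The KKT identity `l - r a = N u ν`, with `r` the multiplier and `N = cos σ /
cos ν`, gives strong duality and the gradient `N β - r d`. On `H` it turns the inequality indexed by
`β` into `⟪β, y⟫ ≤ ⟪u ν, x⟫` (`mem_relaxedSet_iff`).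

Everything then rests on `⟪β, γ⟫ ≤ cos (ν β - ν γ) = ⟪u (ν β), u (ν γ)⟫`
(`inner_le_cos_sub_contactAngle`): each contact vector `(u (ν β), β)` satisfies all the inequalities
and is tight in its own. A point of `C'` violating the inequality of `β`, combined with this contact
vector, yields `‖x‖ < ‖y‖`. A small shift toward a point with uniform slack puts it in the relative
interior of `C'`, so `C'` is not free. -/

namespace QuadraticFree

open Real Filter Topology

/-! ### Plane rotations and angles of elevation. -/

section Frame

variable {E : Type*} [NormedAddCommGroup E] [InnerProductSpace ℝ E]

/-- The rotation of the unit vector `w` by the angle `ν` away from `a`. -/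
noncomputable def rotated (a w : E) (ν : ℝ) : E := cos ν • w - sin ν • a

theorem inner_rotated {a w : E} (ha : ‖a‖ = 1) (hw : ‖w‖ = 1) (haw : inner ℝ a w = 0) (μ ν : ℝ) :
    inner ℝ (rotated a w μ) (rotated a w ν) = cos (μ - ν) := by
  have hwa : inner ℝ w a = 0 := by rw [real_inner_comm]; exact haw
  simp only [rotated, inner_sub_left, inner_sub_right, real_inner_smul_left,
    real_inner_smul_right, haw, hwa, real_inner_self_eq_norm_sq, ha, hw, cos_sub]
  ring

theorem norm_rotated {a w : E} (ha : ‖a‖ = 1) (hw : ‖w‖ = 1) (haw : inner ℝ a w = 0) (ν : ℝ) :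
    ‖rotated a w ν‖ = 1 := by
  have h := inner_rotated ha hw haw ν ν
  rw [real_inner_self_eq_norm_sq, sub_self, cos_zero] at h
  exact (pow_eq_one_iff_of_nonneg (norm_nonneg _) two_ne_zero).1 h

theorem inner_left_rotated {a w : E} (ha : ‖a‖ = 1) (haw : inner ℝ a w = 0) (ν : ℝ) :
    inner ℝ a (rotated a w ν) = -sin ν := by
  simp [rotated, inner_sub_right, real_inner_smul_right, haw, ha]

theorem inner_right_rotated {a w : E} (hw : ‖w‖ = 1) (haw : inner ℝ a w = 0) (ν : ℝ) :
    inner ℝ w (rotated a w ν) = cos ν := by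
  have hwa : inner ℝ w a = 0 := by rw [real_inner_comm]; exact haw
  simp [rotated, inner_sub_right, real_inner_smul_right, hwa, hw]

/-- A unit vector other than `±a` is a rotation of a unit vector orthogonal to `a`. -/
theorem exists_eq_rotated {a l : E} (ha : ‖a‖ = 1) (hl : ‖l‖ = 1) (hla : l ≠ a) (hlna : l ≠ -a) :
    ∃ (w : E) (σ : ℝ), ‖w‖ = 1 ∧ inner ℝ a w = 0 ∧ -(π / 2) < σ ∧ σ < π / 2 ∧
      l = rotated a w (-σ) := by
  have hs1 : inner ℝ l a < 1 := inner_lt_one_iff_real_of_norm_eq_one hl ha |>.2 hla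
  have hs2 : -1 < inner ℝ l a := by
    have := inner_lt_one_iff_real_of_norm_eq_one hl (y := -a) (by simpa using ha) |>.2 hlna
    rw [inner_neg_right] at this
    linarith
  set s : ℝ := inner ℝ l a with hs
  have hk : 0 < cos (arcsin s) := by
    apply cos_pos_of_mem_Ioo
    exact ⟨neg_pi_div_two_lt_arcsin.2 hs2, arcsin_lt_pi_div_two.2 hs1⟩
  have hsin : sin (arcsin s) = s := sin_arcsin hs2.le hs1.le
  have hk2 : cos (arcsin s) ^ 2 = 1 - s ^ 2 := by rw [cos_sq', hsin]
  have hal : inner ℝ a l = s := by rw [real_inner_comm]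
  refine ⟨(cos (arcsin s))⁻¹ • (l - s • a), arcsin s, ?_, ?_,
    neg_pi_div_two_lt_arcsin.2 hs2, arcsin_lt_pi_div_two.2 hs1, ?_⟩
  · have h : ‖l - s • a‖ ^ 2 = cos (arcsin s) ^ 2 := by
      rw [norm_sub_sq_real, hk2, real_inner_smul_right, norm_smul, mul_pow, ha, hl, ← hs]
      simp only [norm_eq_abs, sq_abs]
      ring
    have h' : ‖l - s • a‖ = cos (arcsin s) := (sq_eq_sq₀ (norm_nonneg _) hk.le).1 h
    rw [norm_smul, h', norm_inv, norm_of_nonneg hk.le, inv_mul_cancel₀ hk.ne']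
  · rw [real_inner_smul_right, inner_sub_right, real_inner_smul_right, hal,
      real_inner_self_eq_norm_sq, ha]
    ring
  · simp only [rotated, cos_neg, sin_neg, hsin, smul_smul, mul_inv_cancel₀ hk.ne']
    module

/-- Angles of elevation over the hyperplane orthogonal to `d` are `1`-Lipschitz. -/
theorem inner_le_cos_arcsin_sub_arcsin {d β γ : E} (hd : ‖d‖ < 1) (hβ : ‖β‖ = 1) (hγ : ‖γ‖ = 1) :
    inner ℝ β γ ≤ cos (arcsin (inner ℝ d β) - arcsin (inner ℝ d γ)) := by
  have bound (v : E) : inner ℝ d v ^ 2 ≤ ‖v‖ ^ 2 := by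
    have h1 := abs_real_inner_le_norm d v
    have h2 : ‖d‖ * ‖v‖ ≤ ‖v‖ := by nlinarith [norm_nonneg v]
    exact sq_le_sq.2 (by rw [abs_norm]; linarith)
  have lt_one (v : E) (hv : ‖v‖ = 1) : |inner ℝ d v| < 1 := by
    have h1 := abs_real_inner_le_norm d v
    rw [hv] at h1
    linarith
  have hb := abs_lt.1 (lt_one β hβ)
  have hc := abs_lt.1 (lt_one γ hγ)
  rw [cos_sub, sin_arcsin hb.1.le hb.2.le, sin_arcsin hc.1.le hc.2.le]
  have hp : 0 < cos (arcsin (inner ℝ d β)) := cos_pos_of_mem_Ioo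
    ⟨neg_pi_div_two_lt_arcsin.2 hb.1, arcsin_lt_pi_div_two.2 hb.2⟩
  have hq : 0 < cos (arcsin (inner ℝ d γ)) := cos_pos_of_mem_Ioo
    ⟨neg_pi_div_two_lt_arcsin.2 hc.1, arcsin_lt_pi_div_two.2 hc.2⟩
  have hp2 : cos (arcsin (inner ℝ d β)) ^ 2 = 1 - inner ℝ d β ^ 2 := by
    rw [cos_sq', sin_arcsin hb.1.le hb.2.le]
  have hq2 : cos (arcsin (inner ℝ d γ)) ^ 2 = 1 - inner ℝ d γ ^ 2 := by
    rw [cos_sq', sin_arcsin hc.1.le hc.2.le]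
  generalize cos (arcsin (inner ℝ d β)) = p at *
  generalize cos (arcsin (inner ℝ d γ)) = q at *
  -- With these weights `q² (1 - ⟪d, β⟫²)` and `p² (1 - ⟪d, γ⟫²)` both equal `p² q²`, so a factor `p
  -- q` cancels.
  have h := bound (q • β - p • γ)
  rw [norm_sub_sq_real, inner_sub_right, real_inner_smul_right, real_inner_smul_right,
    real_inner_smul_left, real_inner_smul_right, norm_smul, norm_smul, hβ, hγ, norm_eq_abs,
    norm_eq_abs, mul_one, mul_one, sq_abs, sq_abs] at h
  have h2 : 0 ≤ p * q * (inner ℝ d β * inner ℝ d γ + p * q - inner ℝ β γ) := by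
    have e1 : q ^ 2 * (1 - inner ℝ d β ^ 2) = q ^ 2 * p ^ 2 := by rw [hp2]
    have e2 : p ^ 2 * (1 - inner ℝ d γ ^ 2) = p ^ 2 * q ^ 2 := by rw [hq2]
    nlinarith
  have := nonneg_of_mul_nonneg_right h2 (mul_pos hp hq)
  linarith

end Frame

/-- Truncation is 1-Lipschitz and `cos` decreases on `[0, π]`; this carries the angle estimate from
`arcsin` to contact angles. -/
theorem cos_sub_le_cos_max_sub_max {x y c : ℝ} (h : |x - y| ≤ π) :
    cos (x - y) ≤ cos (max x c - max y c) := by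
  rw [← cos_abs (x - y), ← cos_abs (max x c - max y c)]
  exact cos_le_cos_of_nonneg_of_le_pi (abs_nonneg _) h (abs_max_sub_max_le_abs x y c)

/-! ### Primal and dual solutions, and the gradient of `phi`. -/

/-- An orthonormal pair `a, w`, a vector `d` shorter than `a` and an acute angle `σ`. -/
structure IsFrame {n m : ℕ} (a w : Vec n) (d : Vec m) (σ : ℝ) : Prop where
  norm_a : ‖a‖ = 1
  norm_w : ‖w‖ = 1
  inner_aw : inner ℝ a w = 0
  norm_d : ‖d‖ < 1
  lower : -(π / 2) < σ
  upper : σ < π / 2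

/-- The angle of the maximizer in the problem that defines `phi`. -/
noncomputable def contactAngle {m : ℕ} (σ : ℝ) (d β : Vec m) : ℝ :=
  max (arcsin (inner ℝ d β)) (-σ)

/-- The dual multiplier in terms of the angle of the maximizer. -/
noncomputable def multiplier {m : ℕ} (σ : ℝ) (d β : Vec m) : ℝ :=
  sin σ + cos σ * tan (contactAngle σ d β)

/-- The length of `l - r • a` for the dual multiplier `r`. -/
noncomputable def stretch {m : ℕ} (σ : ℝ) (d β : Vec m) : ℝ :=
  cos σ / cos (contactAngle σ d β)

theorem norm_smul_of_norm_one {E : Type*} [NormedAddCommGroup E] [NormedSpace ℝ E] {v : E}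
    (hv : ‖v‖ = 1) {ρ : ℝ} (hρ : 0 ≤ ρ) : ‖ρ • v‖ = ρ := by
  rw [norm_smul, norm_of_nonneg hρ, hv, mul_one]

theorem exists_smul_of_ne_zero {E : Type*} [NormedAddCommGroup E] [NormedSpace ℝ E] {y : E}
    (hy : y ≠ 0) : ∃ v : E, ‖v‖ = 1 ∧ y = ‖y‖ • v :=
  ⟨‖y‖⁻¹ • y, by simp [norm_smul, hy], by simp [smul_smul, hy]⟩

/-- Weak duality: Cauchy–Schwarz for `l - θ • a`. -/
theorem inner_le_dualObjective {n m : ℕ} (a l : Vec n) (d y : Vec m) {x : Vec n}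
    (hx : x ∈ feasible a d y) {θ : ℝ} (hθ : 0 ≤ θ) :
    inner ℝ l x ≤ dualObjective a l d y θ := by
  obtain ⟨h1, h2⟩ := hx
  have h3 : inner ℝ (l - θ • a) x ≤ ‖l - θ • a‖ * ‖y‖ :=
    (real_inner_le_norm _ _).trans (mul_le_mul_of_nonneg_left h1 (norm_nonneg _))
  rw [inner_sub_left, real_inner_smul_left] at h3
  unfold dualObjective
  nlinarith [mul_nonneg hθ (sub_nonneg.2 h2)]

namespace IsFrame

variable {n m : ℕ} {a w : Vec n} {d β γ : Vec m} {σ : ℝ} (F : IsFrame a w d σ)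
include F

theorem inner_bounds (hβ : ‖β‖ = 1) : -1 < inner ℝ d β ∧ inner ℝ d β < 1 := by
  have h1 := abs_real_inner_le_norm d β
  rw [hβ, mul_one] at h1
  exact abs_lt.1 (h1.trans_lt F.norm_d)

theorem arcsin_bounds (hβ : ‖β‖ = 1) :
    -(π / 2) < arcsin (inner ℝ d β) ∧ arcsin (inner ℝ d β) < π / 2 :=
  ⟨neg_pi_div_two_lt_arcsin.2 (F.inner_bounds hβ).1, arcsin_lt_pi_div_two.2 (F.inner_bounds hβ).2⟩

theorem contactAngle_bounds (hβ : ‖β‖ = 1) :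
    -(π / 2) < contactAngle σ d β ∧ contactAngle σ d β < π / 2 :=
  ⟨lt_max_of_lt_left (F.arcsin_bounds hβ).1,
    max_lt (F.arcsin_bounds hβ).2 (by linarith [F.lower])⟩

theorem cos_pos : 0 < cos σ := cos_pos_of_mem_Ioo ⟨F.lower, F.upper⟩

theorem cos_contactAngle_pos (hβ : ‖β‖ = 1) : 0 < cos (contactAngle σ d β) :=
  cos_pos_of_mem_Ioo (F.contactAngle_bounds hβ)

theorem stretch_pos (hβ : ‖β‖ = 1) : 0 < stretch σ d β :=
  div_pos F.cos_pos (F.cos_contactAngle_pos hβ)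

theorem sin_arcsin_inner (hβ : ‖β‖ = 1) : sin (arcsin (inner ℝ d β)) = inner ℝ d β :=
  sin_arcsin (F.inner_bounds hβ).1.le (F.inner_bounds hβ).2.le

theorem inner_le_sin_contactAngle (hβ : ‖β‖ = 1) : inner ℝ d β ≤ sin (contactAngle σ d β) := by
  rw [← F.sin_arcsin_inner hβ]
  exact sin_le_sin_of_le_of_le_pi_div_two (F.arcsin_bounds hβ).1.le (F.contactAngle_bounds hβ).2.le
    (le_max_left _ _)

theorem multiplier_eq_div (hβ : ‖β‖ = 1) :
    multiplier σ d β = sin (contactAngle σ d β + σ) / cos (contactAngle σ d β) := by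
  have h := F.cos_contactAngle_pos hβ
  rw [multiplier, tan_eq_sin_div_cos, sin_add]
  field_simp
  ring

theorem multiplier_nonneg (hβ : ‖β‖ = 1) : 0 ≤ multiplier σ d β := by
  rw [F.multiplier_eq_div hβ]
  refine div_nonneg (sin_nonneg_of_nonneg_of_le_pi ?_ ?_) (F.cos_contactAngle_pos hβ).le
  · have := le_max_right (arcsin (inner ℝ d β)) (-σ)
    rw [contactAngle]
    linarith
  · linarith [F.upper, F.contactAngle_bounds hβ]

/-- Either the multiplier vanishes and the maximizer is `l`, or the linear constraint is tight. -/
theorem complementarity (hβ : ‖β‖ = 1) :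
    (arcsin (inner ℝ d β) ≤ -σ ∧ contactAngle σ d β = -σ ∧ multiplier σ d β = 0 ∧
      stretch σ d β = 1) ∨
    (-σ < arcsin (inner ℝ d β) ∧ contactAngle σ d β = arcsin (inner ℝ d β) ∧
      sin (contactAngle σ d β) = inner ℝ d β) := by
  rcases le_or_gt (arcsin (inner ℝ d β)) (-σ) with h | h
  · have h1 : contactAngle σ d β = -σ := max_eq_right h
    refine Or.inl ⟨h, h1, ?_, ?_⟩
    · rw [F.multiplier_eq_div hβ, h1]
      simp
    · rw [stretch, h1, cos_neg, div_self F.cos_pos.ne']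
  · have h1 : contactAngle σ d β = arcsin (inner ℝ d β) := max_eq_left h.le
    exact Or.inr ⟨h, h1, by rw [h1, F.sin_arcsin_inner hβ]⟩

theorem multiplier_mul (hβ : ‖β‖ = 1) :
    multiplier σ d β * (inner ℝ d β - sin (contactAngle σ d β)) = 0 := by
  rcases F.complementarity hβ with ⟨-, -, h, -⟩ | ⟨-, -, h⟩
  · rw [h, zero_mul]
  · rw [h, sub_self, mul_zero]

/-- KKT stationarity, the identity behind duality, the gradient and the form of the relaxed set on
`H`. -/
theorem sub_multiplier_smul (hβ : ‖β‖ = 1) :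
    rotated a w (-σ) - multiplier σ d β • a =
      stretch σ d β • rotated a w (contactAngle σ d β) := by
  have h := (F.cos_contactAngle_pos hβ).ne'
  have e : stretch σ d β * cos (contactAngle σ d β) = cos σ := by
    rw [stretch]; field_simp
  have e' : stretch σ d β * sin (contactAngle σ d β) =
      cos σ * tan (contactAngle σ d β) := by
    rw [stretch, tan_eq_sin_div_cos]; field_simp
  rw [rotated, rotated, smul_sub, smul_smul, smul_smul, e, e', multiplier, cos_neg, sin_neg]
  module

theorem norm_sub_multiplier_smul (hβ : ‖β‖ = 1) :
    ‖rotated a w (-σ) - multiplier σ d β • a‖ = stretch σ d β := by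
  rw [F.sub_multiplier_smul hβ, norm_smul_of_norm_one
    (norm_rotated F.norm_a F.norm_w F.inner_aw _) (F.stretch_pos hβ).le]

theorem inner_sub_multiplier_smul (hβ : ‖β‖ = 1) (ν : ℝ) :
    stretch σ d β * cos (contactAngle σ d β - ν) =
      cos (ν + σ) + multiplier σ d β * sin ν := by
  have h := congrArg (fun v => inner ℝ v (rotated a w ν)) (F.sub_multiplier_smul hβ)
  simp only [inner_sub_left, real_inner_smul_left, inner_rotated F.norm_a F.norm_w F.inner_aw,
    inner_left_rotated F.norm_a F.inner_aw] at h
  rw [← h, ← cos_neg (-σ - ν)]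
  ring_nf

theorem dualObjective_multiplier (hβ : ‖β‖ = 1) {ρ : ℝ} (hρ : 0 ≤ ρ) :
    dualObjective a (rotated a w (-σ)) d (ρ • β) (multiplier σ d β) =
      ρ * cos (contactAngle σ d β + σ) := by
  have h := F.inner_sub_multiplier_smul hβ (contactAngle σ d β)
  have h2 := F.multiplier_mul hβ
  rw [sub_self, cos_zero] at h
  rw [dualObjective, F.norm_sub_multiplier_smul hβ, norm_smul_of_norm_one hβ hρ,
    real_inner_smul_right]
  linear_combination ρ * h - ρ * h2

theorem smul_rotated_mem_feasible (hβ : ‖β‖ = 1) {ρ ν : ℝ} (hρ : 0 ≤ ρ)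
    (hν : inner ℝ d β ≤ sin ν) : ρ • rotated a w ν ∈ feasible a d (ρ • β) := by
  refine ⟨?_, ?_⟩
  · rw [norm_smul_of_norm_one hβ hρ, norm_smul_of_norm_one
      (norm_rotated F.norm_a F.norm_w F.inner_aw _) hρ]
  · rw [real_inner_smul_right, real_inner_smul_right, inner_left_rotated F.norm_a F.inner_aw]
    nlinarith

theorem isGreatest_smul (hβ : ‖β‖ = 1) {ρ : ℝ} (hρ : 0 ≤ ρ) :
    IsGreatest ((fun x : Vec n => inner ℝ (rotated a w (-σ)) x) '' feasible a d (ρ • β))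
      (ρ * cos (contactAngle σ d β + σ)) := by
  refine ⟨⟨_, F.smul_rotated_mem_feasible hβ hρ (F.inner_le_sin_contactAngle hβ), ?_⟩, ?_⟩
  · simp only [real_inner_smul_right, inner_rotated F.norm_a F.norm_w F.inner_aw]
    rw [← cos_neg]
    ring_nf
  · rintro _ ⟨x, hx, rfl⟩
    rw [← F.dualObjective_multiplier hβ hρ]
    exact inner_le_dualObjective _ _ _ _ hx (F.multiplier_nonneg hβ)

theorem phi_smul (hβ : ‖β‖ = 1) {ρ : ℝ} (hρ : 0 ≤ ρ) :
    phi a (rotated a w (-σ)) d (ρ • β) = ρ * cos (contactAngle σ d β + σ) :=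
  (F.isGreatest_smul hβ hρ).csSup_eq

theorem phi_unit (hβ : ‖β‖ = 1) :
    phi a (rotated a w (-σ)) d β = cos (contactAngle σ d β + σ) := by
  simpa using F.phi_smul hβ zero_le_one

theorem isGreatest_phi (y : Vec m) :
    IsGreatest ((fun x : Vec n => inner ℝ (rotated a w (-σ)) x) '' feasible a d y)
      (phi a (rotated a w (-σ)) d y) := by
  rcases eq_or_ne y 0 with rfl | hy
  · have h : feasible a d (0 : Vec m) = {0} := by
      ext x
      simp only [feasible, norm_zero, norm_le_zero_iff, Set.mem_ofPred_eq, Set.mem_singleton_iff]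
      exact ⟨fun h => h.1, fun h => by simp [h]⟩
    simp [phi, h]
  · obtain ⟨v, hv, e⟩ := exists_smul_of_ne_zero hy
    rw [e, F.phi_smul hv (norm_nonneg y)]
    exact F.isGreatest_smul hv (norm_nonneg y)

theorem phi_le_dualObjective (y : Vec m) {θ : ℝ} (hθ : 0 ≤ θ) :
    phi a (rotated a w (-σ)) d y ≤ dualObjective a (rotated a w (-σ)) d y θ := by
  obtain ⟨x, hx, e⟩ := (F.isGreatest_phi y).1
  rw [← e]
  exact inner_le_dualObjective _ _ _ _ hx hθ

theorem phi_le_norm (y : Vec m) : phi a (rotated a w (-σ)) d y ≤ ‖y‖ := by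
  have h := F.phi_le_dualObjective y le_rfl
  rwa [dualObjective, zero_smul, sub_zero, norm_rotated F.norm_a F.norm_w F.inner_aw, one_mul,
    zero_mul, sub_zero] at h

theorem relax_eq_multiplier (hβ : ‖β‖ = 1) :
    relax a (rotated a w (-σ)) d β = multiplier σ d β := by
  have hs : inner ℝ (rotated a w (-σ)) a = sin σ := by
    rw [real_inner_comm, inner_left_rotated F.norm_a F.inner_aw, sin_neg, neg_neg]
  have hcase : inner ℝ (rotated a w (-σ)) a + inner ℝ d β ≤ 0 ↔ arcsin (inner ℝ d β) ≤ -σ := by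
    rw [arcsin_le_iff_le_sin ⟨(F.inner_bounds hβ).1.le, (F.inner_bounds hβ).2.le⟩
      ⟨by linarith [F.upper], by linarith [F.lower]⟩, hs, sin_neg]
    constructor <;> intro h <;> linarith
  unfold relax
  rcases F.complementarity hβ with ⟨h, -, h2, -⟩ | ⟨h, -, h2⟩
  · rw [if_pos (hcase.2 h), h2]
  · rw [if_neg (fun h' => h.not_ge (hcase.1 h')), F.phi_unit hβ, hs, ← h2, multiplier,
      tan_eq_sin_div_cos, cos_add]
    have h1 := F.cos_pos.ne'
    have h3 := (F.cos_contactAngle_pos hβ).ne'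
    have h4 := sin_sq_add_cos_sq σ
    generalize cos (contactAngle σ d β) = q at *
    generalize sin (contactAngle σ d β) = t at *
    -- Here `⟪d, β⟫ = sin ν`, so the denominator of `relax` collapses to `cos ν cos σ`.
    have e : q * cos σ - t * sin σ + t * sin σ = q * cos σ := by ring
    rw [e]
    field_simp
    linear_combination (-t) * h4

theorem isMin_dualObjective_iff (hβ : ‖β‖ = 1) (θ : ℝ) :
    (0 ≤ θ ∧ ∀ θ' : ℝ, 0 ≤ θ' → dualObjective a (rotated a w (-σ)) d β θ ≤
      dualObjective a (rotated a w (-σ)) d β θ') ↔ θ = multiplier σ d β := by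
  have hr := F.multiplier_nonneg hβ
  have hopt := F.dualObjective_multiplier hβ zero_le_one
  rw [one_smul, one_mul, ← F.phi_unit hβ] at hopt
  constructor
  · rintro ⟨h0, hmin⟩
    have h1 := (hmin _ hr).trans_eq hopt
    have h3 := F.inner_le_sin_contactAngle hβ
    set u := rotated a w (contactAngle σ d β) with hu
    have hun : ‖u‖ = 1 := norm_rotated F.norm_a F.norm_w F.inner_aw _
    have h4 : inner ℝ (rotated a w (-σ) - θ • a) u = phi a (rotated a w (-σ)) d β +
        θ * sin (contactAngle σ d β) := by
      rw [inner_sub_left, real_inner_smul_left, inner_rotated F.norm_a F.norm_w F.inner_aw,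
        inner_left_rotated F.norm_a F.inner_aw, F.phi_unit hβ, ← cos_neg]
      ring_nf
    rw [dualObjective, hβ, mul_one] at h1
    -- Optimality forces equality in Cauchy–Schwarz, so `l - θ • a` is parallel to `u`; its
    -- components along `w` and `a` determine its length and `θ`.
    have h5 : inner ℝ (rotated a w (-σ) - θ • a) u = ‖rotated a w (-σ) - θ • a‖ * ‖u‖ := by
      refine le_antisymm (real_inner_le_norm _ _) ?_
      rw [hun, h4]
      nlinarith
    rw [inner_eq_norm_mul_iff_real, hun, one_smul] at h5
    set N := ‖rotated a w (-σ) - θ • a‖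
    have ea := congrArg (inner ℝ a) h5
    have ew := congrArg (inner ℝ w) h5
    have hwa : inner ℝ w a = 0 := by rw [real_inner_comm]; exact F.inner_aw
    rw [real_inner_smul_right, inner_sub_right, real_inner_smul_right,
      inner_left_rotated F.norm_a F.inner_aw, inner_left_rotated F.norm_a F.inner_aw,
      real_inner_self_eq_norm_sq, F.norm_a, sin_neg] at ea
    rw [real_inner_smul_right, inner_sub_right, real_inner_smul_right,
      inner_right_rotated F.norm_w F.inner_aw, inner_right_rotated F.norm_w F.inner_aw, hwa,
      cos_neg] at ew
    have hc := (F.cos_contactAngle_pos hβ).ne'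
    have eN : N = cos σ / cos (contactAngle σ d β) := by
      field_simp
      linarith
    rw [multiplier, tan_eq_sin_div_cos]
    rw [eN] at ea
    field_simp at ea ⊢
    linarith
  · rintro rfl
    exact ⟨hr, fun θ' h => hopt.trans_le (F.phi_le_dualObjective β h)⟩

theorem inner_le_cos_sub_contactAngle (hβ : ‖β‖ = 1) (hγ : ‖γ‖ = 1) :
    inner ℝ β γ ≤ cos (contactAngle σ d β - contactAngle σ d γ) := by
  refine (inner_le_cos_arcsin_sub_arcsin F.norm_d hβ hγ).trans (cos_sub_le_cos_max_sub_max ?_)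
  have h1 := F.arcsin_bounds hβ
  have h2 := F.arcsin_bounds hγ
  rw [abs_le]
  constructor <;> linarith

/-- The subgradient inequality for `phi`. -/
theorem inner_subgradient_le_phi (hβ : ‖β‖ = 1) (y : Vec m) :
    inner ℝ (stretch σ d β • β - multiplier σ d β • d) y ≤ phi a (rotated a w (-σ)) d y := by
  rcases eq_or_ne y 0 with rfl | hy
  · obtain ⟨x, hx, e⟩ := (F.isGreatest_phi (0 : Vec m)).1
    have : x = 0 := by simpa using hx.1
    rw [← e, this]
    simp
  obtain ⟨γ, hγ, e⟩ := exists_smul_of_ne_zero hy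
  rw [e]
  rw [F.phi_smul hγ (norm_nonneg y), real_inner_smul_right]
  refine mul_le_mul_of_nonneg_left ?_ (norm_nonneg y)
  rw [inner_sub_left, real_inner_smul_left, real_inner_smul_left]
  rcases F.complementarity hβ with ⟨-, h1, h2, h3⟩ | ⟨-, h1, -⟩
  · have h := F.inner_le_cos_sub_contactAngle hβ hγ
    rw [h1, ← cos_neg] at h
    rw [h2, h3, one_mul, zero_mul, sub_zero]
    refine h.trans_eq ?_
    ring_nf
  · have h := mul_le_mul_of_nonneg_left (inner_le_cos_arcsin_sub_arcsin F.norm_d hβ hγ)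
      (F.stretch_pos hβ).le
    rw [← h1, F.inner_sub_multiplier_smul hβ, F.sin_arcsin_inner hγ] at h
    -- The untruncated angle is also feasible for `γ`, so `cos (arcsin ⟪d, γ⟫ + σ)` is at most `phi`
    -- at `γ`.
    have hmem := F.smul_rotated_mem_feasible hγ zero_le_one (F.sin_arcsin_inner hγ).ge
    rw [one_smul, one_smul] at hmem
    have h4 := (F.isGreatest_phi γ).2 ⟨_, hmem, rfl⟩
    simp only [inner_rotated F.norm_a F.norm_w F.inner_aw] at h4
    rw [F.phi_unit hγ, ← cos_neg, neg_sub, sub_neg_eq_add] at h4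
    linarith

/-- `phi` lies between its linear minorant and the dual objective at the fixed multiplier of `β`.
They differ by `N (‖y‖ - ⟪β, y⟫) ≤ (N / 2) ‖y - β‖²`. -/
theorem hasGradientAt_phi (hβ : ‖β‖ = 1) :
    HasGradientAt (phi a (rotated a w (-σ)) d)
      (stretch σ d β • β - multiplier σ d β • d) β := by
  rw [hasGradientAt_iff_hasFDerivAt]
  set g := stretch σ d β • β - multiplier σ d β • d
  have hN := F.stretch_pos hβ
  have hO : (fun y => phi a (rotated a w (-σ)) d y - inner ℝ g y) =O[𝓝 β]
      fun y => ‖y - β‖ ^ 2 := by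
    refine Asymptotics.IsBigO.of_bound (stretch σ d β / 2) (Eventually.of_forall fun y => ?_)
    have h1 := F.inner_subgradient_le_phi hβ y
    have h2 := F.phi_le_dualObjective y (F.multiplier_nonneg hβ)
    have h3 : ‖y - β‖ ^ 2 = ‖y‖ ^ 2 - 2 * inner ℝ β y + 1 := by
      rw [norm_sub_sq_real, hβ, real_inner_comm, one_pow]
    rw [dualObjective, F.norm_sub_multiplier_smul hβ] at h2
    rw [norm_of_nonneg (sub_nonneg.2 h1), norm_of_nonneg (sq_nonneg _), h3, inner_sub_left,
      real_inner_smul_left, real_inner_smul_left]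
    nlinarith [mul_nonneg hN.le (sq_nonneg (‖y‖ - 1))]
  have h := (hO.hasFDerivAt one_lt_two).add ((InnerProductSpace.toDual ℝ (Vec m) g).hasFDerivAt)
  rw [zero_add] at h
  refine h.congr_of_eventuallyEq (Eventually.of_forall fun y => ?_)
  simp

end IsFrame

/-! ### Freeness and maximality from contact vectors. -/

theorem mem_interior_preimage_iff {X : Type*} [TopologicalSpace X] {H C : Set X} {q : H} :
    q ∈ interior ((Subtype.val : H → X) ⁻¹' C) ↔ C ∈ 𝓝[H] (q : X) := by
  rw [mem_interior_iff_mem_nhds, preimage_coe_mem_nhds_subtype]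

section Contact

variable {n m : ℕ} {a : Vec n} {d : Vec m} {u : Vec m → Vec n} {C : Set (Vec n × Vec m)}

theorem mem_hyperplane {p : Vec n × Vec m} :
    p ∈ hyperplane a d ↔ inner ℝ a p.1 + inner ℝ d p.2 = -1 := Iff.rfl

theorem combo_mem_hyperplane {p q : Vec n × Vec m} (hp : p ∈ hyperplane a d)
    (hq : q ∈ hyperplane a d) (t : ℝ) : (1 - t) • p + t • q ∈ hyperplane a d := by
  rw [mem_hyperplane] at *
  simp only [Prod.fst_add, Prod.snd_add, Prod.smul_fst, Prod.smul_snd, inner_add_right,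
    real_inner_smul_right]
  linear_combination (1 - t) * hp + t * hq

/-- A point of a convex set and a relative interior point span a segment of relative interior
points. -/
theorem mem_nhdsWithin_combo (hC : Convex ℝ C) {p i : Vec n × Vec m} (hp : p ∈ C)
    (hpH : p ∈ hyperplane a d) (hi : i ∈ hyperplane a d) (hiC : C ∈ 𝓝[hyperplane a d] i)
    {t : ℝ} (h0 : 0 < t) (h1 : t ≤ 1) : C ∈ 𝓝[hyperplane a d] ((1 - t) • p + t • i) := by
  have hq := combo_mem_hyperplane hpH hi t
  set q := (1 - t) • p + t • i with hqdef
  -- The inverse of the homothety `v ↦ (1 - t) • p + t • v`.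
  let g : Vec n × Vec m → Vec n × Vec m := fun v => i + t⁻¹ • (v - q)
  have hg : Continuous g := by fun_prop
  have hgq : g q = i := by simp [g]
  have hmaps : Set.MapsTo g (hyperplane a d) (hyperplane a d) := by
    intro v hv
    rw [mem_hyperplane] at *
    simp only [g, Prod.fst_add, Prod.snd_add, Prod.smul_fst, Prod.smul_snd, inner_add_right,
      real_inner_smul_right, Prod.fst_sub, Prod.snd_sub, inner_sub_right]
    linear_combination hi + t⁻¹ * hv - t⁻¹ * hq
  have ht := hg.continuousWithinAt.tendsto_nhdsWithin (x := q) hmaps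
  rw [hgq] at ht
  filter_upwards [ht hiC] with v hv
  have e : v = (1 - t) • p + t • g v := by
    simp only [g, smul_add, smul_smul, mul_inv_cancel₀ h0.ne', hqdef]
    module
  rw [e]
  exact hC hp hv (by linarith) h0.le (by ring)

/-- A set that is cut out on the hyperplane by the inequalities `⟪β, y⟫ ≤ ⟪u β, x⟫` with unit
vectors `u β` is free of points with `‖x‖ ≤ ‖y‖`. -/
theorem disjoint_interior_of_contact (ha : ‖a‖ = 1) (hd : ‖d‖ < 1)
    (hu : ∀ β, ‖β‖ = 1 → ‖u β‖ = 1)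
    (hC : ∀ p ∈ hyperplane a d, p ∈ C → ∀ β, ‖β‖ = 1 → inner ℝ β p.2 ≤ inner ℝ (u β) p.1) :
    Disjoint (interior ((Subtype.val : hyperplane a d → Vec n × Vec m) ⁻¹' C))
      (Subtype.val ⁻¹' homogSet a d) := by
  rw [Set.disjoint_left]
  rintro ⟨q, hq⟩ hqi hqS
  rw [mem_interior_preimage_iff] at hqi
  change C ∈ 𝓝[hyperplane a d] q at hqi
  have hxy : ‖q.1‖ ≤ ‖q.2‖ := hqS.1
  have hy : q.2 ≠ 0 := by
    intro h0
    rw [h0, norm_zero, norm_le_zero_iff] at hxy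
    rw [mem_hyperplane, hxy, h0] at hq
    simp at hq
  obtain ⟨β, hβ, e⟩ := exists_smul_of_ne_zero hy
  have hβq : inner ℝ β q.2 = ‖q.2‖ := by
    rw [e, real_inner_smul_right, real_inner_self_eq_norm_sq, hβ, ← e]
    ring
  have huq : inner ℝ (u β) q.1 ≤ ‖q.1‖ := by
    have := real_inner_le_norm (u β) q.1
    rwa [hu β hβ, one_mul] at this
  -- `w` is `c` times the projection of `(-u β, β)` onto the directions of `H`, with `c = ‖a‖² +
  -- ‖d‖²`. The inequality of `β` has no slack at `q`, and moving along `w` violates it: the gain is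
  -- at least `(1 - ‖d‖)² > 0`.
  set c : ℝ := 1 + ‖d‖ ^ 2 with hc
  set s : ℝ := inner ℝ d β - inner ℝ a (u β) with hs
  let w : Vec n × Vec m := (-(c • u β) - s • a, c • β - s • d)
  have hw : inner ℝ a w.1 + inner ℝ d w.2 = 0 := by
    simp only [w, inner_sub_right, inner_neg_right, real_inner_smul_right,
      real_inner_self_eq_norm_sq, ha]
    rw [hs, hc]; ring
  have hpos : 0 < inner ℝ β w.2 - inner ℝ (u β) w.1 := by
    have e1 : inner ℝ β w.2 - inner ℝ (u β) w.1 = 2 * c - s ^ 2 := by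
      simp only [w, inner_sub_right, inner_neg_right, real_inner_smul_right,
        real_inner_self_eq_norm_sq, hβ, hu β hβ, real_inner_comm a (u β), real_inner_comm d β]
      rw [hs]; ring
    have b1 := abs_le.1 (abs_real_inner_le_norm d β)
    have b2 := abs_le.1 (abs_real_inner_le_norm a (u β))
    rw [hβ] at b1
    rw [ha, hu β hβ] at b2
    have b3 : s ^ 2 ≤ (1 + ‖d‖) ^ 2 := sq_le_sq' (by linarith) (by linarith)
    rw [e1, hc]
    nlinarith
  let f : ℝ → Vec n × Vec m := fun t => q + t • w
  have hf : Continuous f := by fun_prop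
  have hmaps : Set.MapsTo f Set.univ (hyperplane a d) := by
    intro t _
    rw [mem_hyperplane] at *
    simp only [f, Prod.fst_add, Prod.snd_add, Prod.smul_fst, Prod.smul_snd, inner_add_right,
      real_inner_smul_right]
    linear_combination hq + t * hw
  have ht := hf.continuousWithinAt.tendsto_nhdsWithin (x := 0) hmaps
  rw [nhdsWithin_univ, show f 0 = q by simp [f]] at ht
  have htC : ∀ᶠ t in 𝓝 (0 : ℝ), f t ∈ C := ht hqi
  obtain ⟨t, htC, ht0⟩ := ((htC.filter_mono nhdsWithin_le_nhds).and
    (self_mem_nhdsWithin (s := Set.Ioi (0 : ℝ)))).exists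
  have h := hC _ (hmaps (Set.mem_univ t)) htC β hβ
  simp only [f, Prod.fst_add, Prod.snd_add, Prod.smul_fst, Prod.smul_snd, inner_add_right,
      real_inner_smul_right] at h
  nlinarith [mul_pos (show (0 : ℝ) < t from ht0) hpos]

/-- A point with uniform slack lies in the relative interior. -/
theorem mem_nhdsWithin_of_slack (hu : ∀ β, ‖β‖ = 1 → ‖u β‖ = 1)
    (hC : ∀ p ∈ hyperplane a d, (∀ β, ‖β‖ = 1 → inner ℝ β p.2 ≤ inner ℝ (u β) p.1) → p ∈ C)
    {i : Vec n × Vec m} (hi : ∀ β, ‖β‖ = 1 → inner ℝ β i.2 + 1 ≤ inner ℝ (u β) i.1) :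
    C ∈ 𝓝[hyperplane a d] i := by
  rw [Metric.mem_nhdsWithin_iff]
  refine ⟨1 / 2, by norm_num, fun p ⟨hp, hpH⟩ => hC p hpH fun β hβ => ?_⟩
  rw [Metric.mem_ball, dist_eq_norm, Prod.norm_def, max_lt_iff] at hp
  have h1 := abs_le.1 (abs_real_inner_le_norm (u β) (p - i).1)
  have h2 := abs_le.1 (abs_real_inner_le_norm β (p - i).2)
  rw [hu β hβ, one_mul, Prod.fst_sub, inner_sub_right] at h1
  rw [hβ, one_mul, Prod.snd_sub, inner_sub_right] at h2
  rw [Prod.fst_sub, Prod.snd_sub] at hp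
  linarith [hi β hβ]

/-- `v` need only be a limit of relative interior points: `‖v.1‖ < ‖v.2‖` would persist at `v + t •
w` for small `t`, a point of `S ∩ H`. -/
theorem norm_le_of_free {C' : Set (Vec n × Vec m)}
    (hfree : IsFreeWrt (homogSet a d) (hyperplane a d) C') {v w : Vec n × Vec m}
    (hH : ∀ t : ℝ, 0 < t → t < 1 → v + t • w ∈ hyperplane a d)
    (hC' : ∀ t : ℝ, 0 < t → t < 1 → C' ∈ 𝓝[hyperplane a d] (v + t • w)) :
    ‖v.2‖ ≤ ‖v.1‖ := by
  by_contra! hlt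
  have hcont : ContinuousAt (fun t : ℝ => ‖(v + t • w).2‖ - ‖(v + t • w).1‖) 0 := by fun_prop
  have hev : ∀ᶠ t : ℝ in 𝓝[>] 0, 0 < ‖(v + t • w).2‖ - ‖(v + t • w).1‖ :=
    (hcont.eventually (lt_mem_nhds (by simpa using hlt))).filter_mono nhdsWithin_le_nhds
  obtain ⟨t, h1, h0, h2⟩ := (hev.and (Ioo_mem_nhdsGT zero_lt_one)).exists
  have hq := hH t h0 h2
  refine Set.disjoint_left.1 hfree.free
    (mem_interior_preimage_iff.2 (hC' t h0 h2) : (⟨_, hq⟩ : hyperplane a d) ∈ _) ⟨?_, ?_⟩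
  · exact (sub_pos.1 h1).le
  · rw [mem_hyperplane] at hq
    exact hq.trans_le (by norm_num)

/-- Maximality, when the vectors `(u β, β)` satisfy all inequalities and at some point all of
them have uniform slack. -/
theorem inter_subset_of_contact (hu : ∀ β, ‖β‖ = 1 → ‖u β‖ = 1)
    (hle : ∀ β, ‖β‖ = 1 → inner ℝ a (u β) + inner ℝ d β ≤ 0)
    (hkey : ∀ β γ, ‖β‖ = 1 → ‖γ‖ = 1 → inner ℝ β γ ≤ inner ℝ (u β) (u γ))
    {c : Vec n × Vec m} (hc : c ∈ hyperplane a d)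
    (hslack : ∀ β, ‖β‖ = 1 → inner ℝ β c.2 + 1 ≤ inner ℝ (u β) c.1)
    (hC : ∀ p ∈ hyperplane a d, (∀ β, ‖β‖ = 1 → inner ℝ β p.2 ≤ inner ℝ (u β) p.1) → p ∈ C)
    {C' : Set (Vec n × Vec m)} (hCC' : C ⊆ C')
    (hfree : IsFreeWrt (homogSet a d) (hyperplane a d) C') :
    C' ∩ hyperplane a d ⊆ C ∩ hyperplane a d := by
  rintro p ⟨hpC', hpH⟩
  refine ⟨hC p hpH fun β hβ => ?_, hpH⟩
  by_contra! hlt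
  set e : Vec n × Vec m := (u β, β) with he
  have hcC' : C' ∈ 𝓝[hyperplane a d] c := mem_of_superset (mem_nhdsWithin_of_slack hu hC hslack) hCC'
  have hpos : 0 < inner ℝ β p.2 - inner ℝ (u β) p.1 := sub_pos.2 hlt
  set g := inner ℝ β p.2 - inner ℝ (u β) p.1 with hg
  rcases (hle β hβ).lt_or_eq with hneg | hzero
  -- The contact vector can be scaled into `H`, and then lies in `C`.
  · set ρ : ℝ := -(inner ℝ a (u β) + inner ℝ d β)⁻¹ with hρ
    have hρ0 : 0 < ρ := neg_pos.2 (inv_lt_zero.2 hneg)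
    have hz : ρ • e ∈ hyperplane a d := by
      rw [mem_hyperplane]
      simp only [he, Prod.smul_fst, Prod.smul_snd, real_inner_smul_right]
      rw [← mul_add, hρ, neg_mul, inv_mul_cancel₀ hneg.ne]
    have hzC' : ρ • e ∈ C' := hCC' <| hC _ hz fun γ hγ => by
      simp only [he, Prod.smul_fst, Prod.smul_snd, real_inner_smul_right]
      exact mul_le_mul_of_nonneg_left (hkey γ β hγ hβ) hρ0.le
    -- Chosen so that `2 (1 - ε) ρ g = ε (‖p.1‖² + 1)`, which outweighs `-ε ‖p.1‖²`.
    set ε : ℝ := 2 * ρ * g / (2 * ρ * g + ‖p.1‖ ^ 2 + 1) with hε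
    have hden : 0 < 2 * ρ * g + ‖p.1‖ ^ 2 + 1 := by positivity
    have hε0 : 0 < ε := by positivity
    have hε1 : ε < 1 := by
      rw [hε, div_lt_one hden]
      nlinarith [sq_nonneg ‖p.1‖]
    have hεd : ε * (2 * ρ * g + ‖p.1‖ ^ 2 + 1) = 2 * ρ * g := div_mul_cancel₀ _ hden.ne'
    have hcombo (t : ℝ) : (1 - ε) • ρ • e + ε • p + t • (1 - ε) • (c - ρ • e) =
        (1 - (1 - ε)) • p + (1 - ε) • ((1 - t) • ρ • e + t • c) := by module
    have h := norm_le_of_free hfree (v := (1 - ε) • ρ • e + ε • p) (w := (1 - ε) • (c - ρ • e))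
      (fun t h0 h1 => by
        rw [hcombo]
        exact combo_mem_hyperplane hpH (combo_mem_hyperplane hz hc _) _)
      (fun t h0 h1 => by
        rw [hcombo]
        exact mem_nhdsWithin_combo hfree.convex hpC' hpH (combo_mem_hyperplane hz hc _)
          (mem_nhdsWithin_combo hfree.convex hzC' hz hc hcC' h0 h1.le) (by linarith)
          (by linarith))
    rw [← sq_le_sq₀ (norm_nonneg _) (norm_nonneg _)] at h
    simp only [he, Prod.fst_add, Prod.snd_add, Prod.smul_fst, Prod.smul_snd] at h
    rw [norm_add_sq_real, norm_add_sq_real] at h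
    simp only [norm_smul, real_inner_smul_left, real_inner_smul_right, hβ, hu β hβ, mul_pow,
      norm_eq_abs, sq_abs] at h
    have h2 : ε * (2 * (1 - ε) * ρ * g + ε * (‖p.2‖ ^ 2 - ‖p.1‖ ^ 2)) ≤ 0 := by
      rw [hg]; linarith
    have h3 : 0 < 2 * (1 - ε) * ρ * g + ε * (‖p.2‖ ^ 2 - ‖p.1‖ ^ 2) := by
      nlinarith [mul_nonneg hε0.le (sq_nonneg ‖p.2‖)]
    exact absurd h2 (mul_pos hε0 h3).not_ge
  -- Now `e` is a direction of `H` that preserves slack. `p + M • e` is a limit of relative interior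
  -- points, and `2 M g = ‖p.1‖² + 1` makes its second component the longer one.
  · set M : ℝ := (‖p.1‖ ^ 2 + 1) / (2 * g) with hM
    have hM0 : 0 < M := by positivity
    have hMg : 2 * M * g = ‖p.1‖ ^ 2 + 1 := by
      rw [hM]; field_simp
    have hray (t : ℝ) : c + t • e ∈ hyperplane a d := by
      rw [mem_hyperplane] at *
      simp only [he, Prod.fst_add, Prod.snd_add, Prod.smul_fst, Prod.smul_snd, inner_add_right,
        real_inner_smul_right]
      linear_combination hc + t * hzero
    have hrayC' (t : ℝ) (ht : 0 ≤ t) : C' ∈ 𝓝[hyperplane a d] (c + t • e) := by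
      refine mem_of_superset (mem_nhdsWithin_of_slack hu hC fun γ hγ => ?_) hCC'
      simp only [he, Prod.fst_add, Prod.snd_add, Prod.smul_fst, Prod.smul_snd, inner_add_right,
        real_inner_smul_right]
      nlinarith [hslack γ hγ, mul_le_mul_of_nonneg_left (hkey γ β hγ hβ) ht]
    have hcombo (t : ℝ) (h0 : 0 < t) : p + M • e + t • (c - p) =
        (1 - t) • p + t • (c + (M / t) • e) := by
      rw [smul_add t c, smul_smul, mul_div_cancel₀ M h0.ne']
      module
    have h := norm_le_of_free hfree (v := p + M • e) (w := c - p)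
      (fun t h0 h1 => by
        rw [hcombo t h0]
        exact combo_mem_hyperplane hpH (hray _) _)
      (fun t h0 h1 => by
        rw [hcombo t h0]
        exact mem_nhdsWithin_combo hfree.convex hpC' hpH (hray _) (hrayC' _ (by positivity))
          h0 h1.le)
    rw [← sq_le_sq₀ (norm_nonneg _) (norm_nonneg _)] at h
    simp only [he, Prod.fst_add, Prod.snd_add, Prod.smul_fst, Prod.smul_snd] at h
    rw [norm_add_sq_real, norm_add_sq_real] at h
    simp only [norm_smul, real_inner_smul_right, hβ, hu β hβ, mul_pow,
      norm_eq_abs, sq_abs] at h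
    rw [real_inner_comm, real_inner_comm (u β)] at h
    nlinarith [sq_nonneg ‖p.2‖]

end Contact

/-! ### The relaxed set. -/

theorem isClosed_relaxedSet {n m : ℕ} (a l : Vec n) (d : Vec m) :
    IsClosed (relaxedSet a l d) := by
  have : relaxedSet a l d = ⋂ (β : Vec m) (_ : ‖β‖ = 1), {p | -inner ℝ l p.1 +
      inner ℝ (gradient (phi a l d) β) p.2 ≤ relax a l d β} := by
    ext p; simp [relaxedSet]
  rw [this]
  exact isClosed_iInter fun β => isClosed_iInter fun _ =>
    isClosed_le (by fun_prop) continuous_const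

theorem convex_relaxedSet {n m : ℕ} (a l : Vec n) (d : Vec m) :
    Convex ℝ (relaxedSet a l d) := by
  intro p hp q hq s t hs ht hst β hβ
  have h1 := mul_le_mul_of_nonneg_left (hp β hβ) hs
  have h2 := mul_le_mul_of_nonneg_left (hq β hβ) ht
  have h3 : (s + t) * relax a l d β = relax a l d β := by rw [hst, one_mul]
  simp only [Prod.fst_add, Prod.snd_add, Prod.smul_fst, Prod.smul_snd, inner_add_right,
    real_inner_smul_right]
  linarith

namespace IsFrame

variable {n m : ℕ} {a w : Vec n} {d : Vec m} {σ : ℝ} (F : IsFrame a w d σ)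
include F

theorem gradient_phi {β : Vec m} (hβ : ‖β‖ = 1) :
    gradient (phi a (rotated a w (-σ)) d) β = stretch σ d β • β - multiplier σ d β • d :=
  (F.hasGradientAt_phi hβ).gradient

/-- Substituting `⟪d, y⟫ = -1 - ⟪a, x⟫` absorbs `r` into `l - r a = N u ν`; the positive factor `N`
then cancels. -/
theorem mem_relaxedSet_iff {p : Vec n × Vec m} (hp : p ∈ hyperplane a d) :
    p ∈ relaxedSet a (rotated a w (-σ)) d ↔
      ∀ β, ‖β‖ = 1 → inner ℝ β p.2 ≤ inner ℝ (rotated a w (contactAngle σ d β)) p.1 := by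
  refine forall₂_congr fun β hβ => ?_
  rw [F.gradient_phi hβ, F.relax_eq_multiplier hβ, inner_sub_left, real_inner_smul_left,
    real_inner_smul_left]
  have h := congrArg (fun v => inner ℝ v p.1) (F.sub_multiplier_smul hβ)
  simp only [inner_sub_left, real_inner_smul_left] at h
  rw [mem_hyperplane] at hp
  rw [← mul_le_mul_iff_right₀ (F.stretch_pos hβ) (b := inner ℝ β p.2), ← h]
  have e : multiplier σ d β * inner ℝ d p.2 =
    -multiplier σ d β - multiplier σ d β * inner ℝ a p.1 := by
    linear_combination multiplier σ d β * hp
  rw [e]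
  constructor <;> intro h <;> linarith

theorem exists_slack : ∃ c ∈ hyperplane a d, ∀ β : Vec m, ‖β‖ = 1 →
    inner ℝ β c.2 + 1 ≤ inner ℝ (rotated a w (contactAngle σ d β)) c.1 := by
  set k := min (cos σ) (cos (arcsin ‖d‖)) with hk
  have hd0 := norm_nonneg d
  have had : arcsin ‖d‖ < π / 2 := arcsin_lt_pi_div_two.2 F.norm_d
  have had0 : 0 ≤ arcsin ‖d‖ := arcsin_nonneg.2 hd0
  have hk0 : 0 < k := lt_min F.cos_pos (cos_pos_of_mem_Ioo ⟨by linarith [pi_pos], had⟩)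
  -- `-a` puts the point on `H` and costs at most `1` against any contact vector; since `k ≤ cos ν`
  -- for every contact angle `ν`, `(2 / k) • w` gains at least `2`.
  refine ⟨(-a + (2 / k) • w, 0), ?_, fun β hβ => ?_⟩
  · simp [mem_hyperplane, inner_add_right, real_inner_smul_right, F.inner_aw, F.norm_a]
  · have hcos : k ≤ cos (contactAngle σ d β) := by
      rcases F.complementarity hβ with ⟨-, h, -, -⟩ | ⟨-, h, -⟩
      · rw [h, cos_neg]
        exact min_le_left _ _
      · rw [h]
        refine (min_le_right _ _).trans ?_
        rw [← cos_abs (arcsin (inner ℝ d β))]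
        have hb := abs_le.1 (abs_real_inner_le_norm d β)
        rw [hβ, mul_one] at hb
        refine cos_le_cos_of_nonneg_of_le_pi (abs_nonneg _) (by linarith [pi_pos]) ?_
        rw [abs_le, ← arcsin_neg]
        exact ⟨monotone_arcsin hb.1, monotone_arcsin hb.2⟩
    have h1 : 2 ≤ 2 / k * cos (contactAngle σ d β) := by
      rw [div_mul_eq_mul_div, le_div_iff₀ hk0]
      linarith
    rw [real_inner_comm (-a + (2 / k) • w)]
    simp only [inner_zero_right, inner_add_left, inner_neg_left, real_inner_smul_left,
      inner_left_rotated F.norm_a F.inner_aw, inner_right_rotated F.norm_w F.inner_aw]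
    linarith [neg_one_le_sin (contactAngle σ d β)]

theorem isMaximalFreeWrt_relaxedSet :
    IsMaximalFreeWrt (homogSet a d) (hyperplane a d) (relaxedSet a (rotated a w (-σ)) d) := by
  have hu : ∀ β : Vec m, ‖β‖ = 1 → ‖rotated a w (contactAngle σ d β)‖ = 1 :=
    fun β _ => norm_rotated F.norm_a F.norm_w F.inner_aw _
  obtain ⟨c, hc, hslack⟩ := F.exists_slack
  refine ⟨⟨isClosed_relaxedSet _ _ _, convex_relaxedSet _ _ _, ?_⟩, fun C' hCC' hfree => ?_⟩
  · exact disjoint_interior_of_contact F.norm_a F.norm_d hu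
      fun p hp => (F.mem_relaxedSet_iff hp).1
  · refine inter_subset_of_contact hu (fun β hβ => ?_) (fun β γ hβ hγ => ?_) hc hslack
      (fun p hp => (F.mem_relaxedSet_iff hp).2) hCC' hfree
    · rw [inner_left_rotated F.norm_a F.inner_aw]
      linarith [F.inner_le_sin_contactAngle hβ]
    · rw [inner_rotated F.norm_a F.norm_w F.inner_aw]
      exact F.inner_le_cos_sub_contactAngle hβ hγ

/-- The open cone `‖y‖ < ⟪l, x⟫` lies in the set, because `⟪∇φ(β), y⟫ ≤ φ(y) ≤ ‖y‖` and `r ≥ 0`. -/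
theorem mem_interior_relaxedSet {x : Vec n} {y : Vec m}
    (hxy : ‖y‖ < inner ℝ (rotated a w (-σ)) x) :
    (x, y) ∈ interior (relaxedSet a (rotated a w (-σ)) d) := by
  refine mem_interior.2 ⟨{p | ‖p.2‖ < inner ℝ (rotated a w (-σ)) p.1}, fun p hp β hβ => ?_,
    isOpen_lt (by fun_prop) (by fun_prop), hxy⟩
  have hp' : ‖p.2‖ < inner ℝ (rotated a w (-σ)) p.1 := hp
  rw [F.gradient_phi hβ, F.relax_eq_multiplier hβ]
  linarith [F.inner_subgradient_le_phi hβ p.2, F.phi_le_norm p.2, F.multiplier_nonneg hβ]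

end IsFrame

end QuadraticFree

theorem mainTheorem1 {n m : ℕ} (a l : QuadraticFree.Vec n) (d : QuadraticFree.Vec m)
    (ha : ‖a‖ = 1) (hd : ‖d‖ < ‖a‖) (hl : ‖l‖ = 1) (hla : l ≠ a) (hlna : l ≠ -a) :
    -- `φ_λ` is a maximum, and it is differentiable at unit vectors
    (∀ y, IsGreatest ((fun x : QuadraticFree.Vec n => inner ℝ l x) ''
        QuadraticFree.feasible a d y) (QuadraticFree.phi a l d y)) ∧
    (∀ β, ‖β‖ = 1 → DifferentiableAt ℝ (QuadraticFree.phi a l d) β) ∧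
    -- `r(β)` is the unique optimal dual solution, and its dual value is `φ_λ(β)`
    (∀ β, ‖β‖ = 1 →
      (∀ θ : ℝ, (0 ≤ θ ∧ ∀ θ' : ℝ, 0 ≤ θ' →
          QuadraticFree.dualObjective a l d β θ ≤ QuadraticFree.dualObjective a l d β θ') ↔
        θ = QuadraticFree.relax a l d β) ∧
      QuadraticFree.dualObjective a l d β (QuadraticFree.relax a l d β) =
        QuadraticFree.phi a l d β) ∧
    -- the relaxed set is maximal `S_{≤0}`-free with respect to `H`
    QuadraticFree.IsMaximalFreeWrt (QuadraticFree.homogSet a d) (QuadraticFree.hyperplane a d)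
      (QuadraticFree.relaxedSet a l d) ∧
    -- it contains the given point in its interior
    (∀ (x : QuadraticFree.Vec n) (y : QuadraticFree.Vec m),
      (x, y) ∈ QuadraticFree.hyperplane a d → ‖y‖ < ‖x‖ → l = ‖x‖⁻¹ • x →
        (x, y) ∈ interior (QuadraticFree.relaxedSet a l d)) := by
  obtain ⟨w, σ, hw, haw, h1, h2, rfl⟩ := QuadraticFree.exists_eq_rotated ha hl hla hlna
  have F : QuadraticFree.IsFrame a w d σ := ⟨ha, hw, haw, hd.trans_eq ha, h1, h2⟩
  refine ⟨F.isGreatest_phi, fun β hβ => (F.hasGradientAt_phi hβ).differentiableAt,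
    fun β hβ => ?_, F.isMaximalFreeWrt_relaxedSet, fun x y _ hxy hlx => ?_⟩
  · rw [F.relax_eq_multiplier hβ]
    refine ⟨F.isMin_dualObjective_iff hβ, ?_⟩
    simpa [F.phi_unit hβ] using F.dualObjective_multiplier hβ zero_le_one
  · refine F.mem_interior_relaxedSet ?_
    have hx : ‖x‖ ≠ 0 := ((norm_nonneg y).trans_lt hxy).ne'
    rw [hlx, real_inner_smul_left, real_inner_self_eq_norm_sq]
    field_simp
    exact hxy
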